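/- Let $X$ be a topological space (no separation axioms are assumed). An open cover of $X$ is a set of open subsets of $X$ with union $X$; an $\omega$-cover of $X$ is an open cover $\mathscr U$ such that every finite subset of $X$ is contained in some member of $\mathscr U$. Let $\mathcal O_X$ and $\Omega_X$ be the collections of all open covers and of all $\omega$-covers of $X$. For collections $\mathcal A,\mathcal B$ of sets, in the game $\mathsf G_{\mathrm{fin}}(\mathcal A,\mathcal B)$ (resp. $\mathsf G_1(\mathcal A,\mathcal B)$) in each round $n\in\omega$ Player 1 plays $A_n\in\mathcal A$ and Player 2 answers with a finite set $\mathscr F_n\subseteq A_n$ (resp. an element $x_n\in A_n$); Player 2 wins if $\bigcup_n\mathscr F_n\in\mathcal B$ (resp. $\{x_n:n\in\omega\}\in\mathcal B$). The space $X$ is strategically Menger, strategically $\omega$-Menger, strategically Rothberger, or strategically $\omega$-Rothberger if Player 2 has a winning (full-information) strategy in $\mathsf G_{\mathrm{fin}}(\mathcal O_X,\mathcal O_X)$, $\mathsf G_{\mathrm{fin}}(\Omega_X,\Omega_X)$, $\mathsf G_1(\mathcal O_X,\mathcal O_X)$, or $\mathsf G_1(\Omega_X,\Omega_X)$, respectively.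 Then: (1) $X$ is strategically $\omega$-Menger if and only if it is strategically Menger. (2) If $X$ is non-empty, then $X$ is strategically $\omega$-Rothberger if and only if it is strategically Rothberger. -/

import Mathlib

/-- The collection of all open covers of `X`; a cover is a set of open subsets of `X`. -/
def openCovers (X : Type*) [TopologicalSpace X] : Set (Set (Set X)) :=
  {𝒰 | (∀ U ∈ 𝒰, IsOpen U) ∧ ⋃₀ 𝒰 = Set.univ}

/-- The collection of all `ω`-covers of `X`: open covers such that every finite subset of `X` is
contained in a single member. -/
def omegaCovers (X : Type*) [TopologicalSpace X] : Set (Set (Set X)) :=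
  {𝒰 | 𝒰 ∈ openCovers X ∧ ∀ F : Set X, F.Finite → ∃ U ∈ 𝒰, F ⊆ U}

/-- Player 2 has a winning strategy in the single-selection game `G₁(𝒜, ℬ)`: in round `n`
Player 1 plays `A n ∈ 𝒜`, Player 2 answers with an element of `A n`, and Player 2 wins when the
set of all answers belongs to `ℬ`. The answer `σ n s` in round `n` may depend on all of the moves
`s 0, …, s n` made so far by Player 1. -/
def P2WinsSingle {α : Type*} (𝒜 ℬ : Set (Set α)) : Prop :=
  ∃ σ : (n : ℕ) → (Fin (n + 1) → 𝒜) → α,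
    (∀ (n : ℕ) (s : Fin (n + 1) → 𝒜), σ n s ∈ (s (Fin.last n) : Set α)) ∧
    ∀ A : ℕ → 𝒜, Set.range (fun n : ℕ => σ n (fun i => A i)) ∈ ℬ

/-- Player 2 has a winning strategy in the finite-selection game `G_fin(𝒜, ℬ)`: in round `n`
Player 1 plays `A n ∈ 𝒜`, Player 2 answers with a finite subset of `A n`, and Player 2 wins when
the union of all answers belongs to `ℬ`. -/
def P2WinsFin {α : Type*} (𝒜 ℬ : Set (Set α)) : Prop :=
  ∃ σ : (n : ℕ) → (Fin (n + 1) → 𝒜) → Finset α,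
    (∀ (n : ℕ) (s : Fin (n + 1) → 𝒜), (σ n s : Set α) ⊆ (s (Fin.last n) : Set α)) ∧
    ∀ A : ℕ → 𝒜, (⋃ n : ℕ, (σ n (fun i => A i) : Set α)) ∈ ℬ

def StrategicallyMenger (X : Type*) [TopologicalSpace X] : Prop :=
  P2WinsFin (openCovers X) (openCovers X)

def StrategicallyOmegaMenger (X : Type*) [TopologicalSpace X] : Prop :=
  P2WinsFin (omegaCovers X) (omegaCovers X)

def StrategicallyRothberger (X : Type*) [TopologicalSpace X] : Prop :=
  P2WinsSingle (openCovers X) (openCovers X)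

def StrategicallyOmegaRothberger (X : Type*) [TopologicalSpace X] : Prop :=
  P2WinsSingle (omegaCovers X) (omegaCovers X)

open Filter Function Set TopologicalSpace

/-! Both passages to the `ω`-game rest on branching: a player follows a winning strategy on all
subsequences of the play at once. Only finitely many positions occur in each round, so a finite
selection can serve them all, and a point missed in infinitely many rounds would be missed in a
whole play of the original game.

In the Menger game, described by open neighbourhood assignments, branching makes winning strategies
cover each point in all but finitely many rounds, and this yields strategies on finite products.
The sets `U ^ m`, with `U` in an `ω`-cover of `X`, cover `X ^ m`; playing on all the powers `X ^ m`
simultaneously gives the `ω`-Menger strategy. Conversely, an open cover generates the `ω`-cover of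
the finite unions of its members.

The Rothberger games are dual to the point-open game and the finite-open game, by Galvin's argument.
Branching turns a strategy of Player 1 in the point-open game into one in the finite-open game.
Conversely, Player 1 names the points of a finite set one after another, and the union of the sets
played so far serves as the answer to the whole finite set.
-/

universe u v

/-- A machine reading moves in `γ`, used to describe full-information strategies: it starts in the
state `start` and the move `a` takes it from the state `s` to `step s a`. A strategy is given by
such a machine and a function choosing an answer from the current state. -/
structure Memory (S γ : Type*) where
  start : S
  step : S → γ → S

namespace Memory

variable {S γ δ : Type*} (M : Memory S γ)

/-- The state of the machine `M` after it has read the moves `A 0, …, A (n - 1)`. -/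
def after (A : ℕ → γ) : ℕ → S
  | 0 => M.start
  | n + 1 => M.step (after A n) (A n)

theorem after_zero (A : ℕ → γ) : M.after A 0 = M.start := rfl

theorem after_succ (A : ℕ → γ) (n : ℕ) : M.after A (n + 1) = M.step (M.after A n) (A n) := rfl

variable {M}

theorem eq_after {A : ℕ → γ} {s : ℕ → S} (hzero : s 0 = M.start)
    (hsucc : ∀ n, s (n + 1) = M.step (s n) (A n)) (n : ℕ) : s n = M.after A n := by
  induction n with
  | zero => exact hzero
  | succ n ih => rw [hsucc, ih, after_succ]

theorem eq_after_nth_count {A : ℕ → γ} {s : ℕ → S} {P : ℕ → Prop} [DecidablePred P]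
    (hzero : s 0 = M.start) (hsucc : ∀ n, s (n + 1) = if P n then M.step (s n) (A n) else s n)
    (n : ℕ) : s n = M.after (A ∘ Nat.nth P) (Nat.count P n) := by
  induction n with
  | zero => rw [Nat.count_zero, hzero, after_zero]
  | succ n ih =>
    by_cases hn : P n
    · simp [hsucc, Nat.count_succ, after_succ, hn, Nat.nth_count, ← ih]
    · simp [hsucc, Nat.count_succ, hn, ← ih]

theorem after_eq_foldl (A : ℕ → γ) (n : ℕ) :
    M.after A n = Fin.foldl n (fun s i => M.step s (A i)) M.start := by
  induction n with
  | zero => simp [after_zero]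
  | succ n ih => simp [after_succ, Fin.foldl_succ_last, ih]

/-- The machine that remembers all moves. -/
def history (γ : Type*) : Memory (Σ n, Fin n → γ) γ where
  start := ⟨0, Fin.elim0⟩
  step s a := ⟨s.1 + 1, Fin.snoc s.2 a⟩

theorem after_history (A : ℕ → γ) (n : ℕ) :
    (history γ).after A n = ⟨n, fun i => A i⟩ := by
  refine (eq_after (M := history γ) (s := fun n => ⟨n, fun i => A i⟩) ?_ (fun n => ?_) n).symm
  · exact congrArg (Sigma.mk 0) (Subsingleton.elim _ _)
  · exact congrArg (Sigma.mk (n + 1)) (Fin.snoc_init_self fun i : Fin (n + 1) => A i).symm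

variable (M)

/-- The machine that reads a move through the translation `f`. -/
def comap (f : δ → γ) : Memory S δ where
  start := M.start
  step s a := M.step s (f a)

theorem after_comap (f : δ → γ) (A : ℕ → δ) (n : ℕ) :
    (M.comap f).after A n = M.after (f ∘ A) n :=
  eq_after rfl (fun _ => rfl) n

open Classical in
/-- The nondeterministic version of the machine `M`. It reads finite sets of moves and keeps track
of all states that `M` can reach by reading, in each round, at most one of the given moves. -/
noncomputable def branch : Memory (Finset S) (Finset γ) where
  start := {M.start}
  step T F := T ∪ Finset.image₂ M.step T F

theorem after_nth_count_mem_branch {A : ℕ → γ} {F : ℕ → Finset γ} {P : ℕ → Prop}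
    [DecidablePred P] (hA : ∀ n, P n → A n ∈ F n) (n : ℕ) :
    M.after (A ∘ Nat.nth P) (Nat.count P n) ∈ M.branch.after F n := by
  classical
  induction n with
  | zero => exact Finset.mem_singleton_self M.start
  | succ n ih =>
    rw [after_succ]
    by_cases hn : P n
    · rw [Nat.count_succ, if_pos hn, after_succ, comp_apply, Nat.nth_count hn]
      exact Finset.mem_union_right _ (Finset.mem_image₂_of_mem ih (hA n hn))
    · rw [Nat.count_succ, if_neg hn]
      exact Finset.mem_union_left _ ih

variable {M}

/-- The rounds satisfying `P` form a play of their own, and `M.branch` follows it. -/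
theorem exists_mem_branch {Q : S → γ → Prop} (hQ : ∀ A : ℕ → γ, ∃ n, Q (M.after A n) (A n))
    {A : ℕ → γ} {F : ℕ → Finset γ} {P : ℕ → Prop} (hP : ∃ᶠ n in atTop, P n)
    (hA : ∀ n, P n → A n ∈ F n) : ∃ n, P n ∧ ∃ s ∈ M.branch.after F n, Q s (A n) := by
  classical
  have hinf := Nat.frequently_atTop_iff_infinite.1 hP
  obtain ⟨k, hk⟩ := hQ (A ∘ Nat.nth P)
  have hmem := M.after_nth_count_mem_branch hA (Nat.nth P k)
  rw [Nat.count_nth_of_infinite hinf] at hmem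
  exact ⟨Nat.nth P k, Nat.nth_mem_of_infinite hinf k, _, hmem, hk⟩

theorem exists_answer_superset {S : ℕ → Type*} {α : Type*} (M : ∀ m, Memory (S m) γ)
    (answer : ∀ m, S m → γ → Finset α) :
    ∃ (N : Memory (ℕ × ∀ m, S m) γ) (joint : ℕ × (∀ m, S m) → γ → Finset α),
      (∀ s a, ∀ x ∈ joint s a, ∃ m t, x ∈ answer m t a) ∧
      ∀ A m n, m ≤ n → answer m ((M m).after A n) (A n) ⊆ joint (N.after A n) (A n) := by
  classical
  let N : Memory (ℕ × ∀ m, S m) γ :=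
    { start := (0, fun m => (M m).start)
      step := fun s a => (s.1 + 1, fun m => (M m).step (s.2 m) a) }
  have hN : ∀ A n, N.after A n = (n, fun m => (M m).after A n) := fun A n =>
    (eq_after (s := fun n => (n, fun m => (M m).after A n)) rfl (fun _ => rfl) n).symm
  refine ⟨N, fun s a => (Finset.range (s.1 + 1)).biUnion fun m => answer m (s.2 m) a,
    fun s a x hx => ?_, fun A m n hmn => ?_⟩
  · obtain ⟨m, -, hm⟩ := Finset.mem_biUnion.1 hx
    exact ⟨m, s.2 m, hm⟩
  · rw [hN]
    exact Finset.subset_biUnion_of_mem (fun m => answer m ((M m).after A n) (A n))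
      (Finset.mem_range_succ_iff.2 hmn)

end Memory

section Games

variable {α : Type*} {𝒜 ℬ : Set (Set α)}

theorem P2WinsFin.of_memory {S : Type*} (M : Memory S 𝒜) (answer : S → 𝒜 → Finset α)
    (hanswer : ∀ s (A : 𝒜), (answer s A : Set α) ⊆ A)
    (hwin : ∀ A : ℕ → 𝒜, (⋃ n, (answer (M.after A n) (A n) : Set α)) ∈ ℬ) : P2WinsFin 𝒜 ℬ := by
  refine ⟨fun n s => answer (Fin.foldl n (fun t i => M.step t (s i.castSucc)) M.start)
    (s (Fin.last n)), fun n s => hanswer _ _, fun A => ?_⟩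
  simpa only [Memory.after_eq_foldl, Fin.val_castSucc, Fin.val_last] using hwin A

theorem P2WinsSingle.of_memory {S : Type*} (M : Memory S 𝒜) (answer : S → 𝒜 → α)
    (hanswer : ∀ s (A : 𝒜), answer s A ∈ (A : Set α))
    (hwin : ∀ A : ℕ → 𝒜, range (fun n => answer (M.after A n) (A n)) ∈ ℬ) :
    P2WinsSingle 𝒜 ℬ := by
  refine ⟨fun n s => answer (Fin.foldl n (fun t i => M.step t (s i.castSucc)) M.start)
    (s (Fin.last n)), fun n s => hanswer _ _, fun A => ?_⟩
  simpa only [Memory.after_eq_foldl, Fin.val_castSucc, Fin.val_last] using hwin A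

variable {C : Type u} {ι : Type*}

theorem P2WinsFin.exists_memory (h : P2WinsFin 𝒜 ℬ) (A : C → ι → α)
    (hA : ∀ c, range (A c) ∈ 𝒜) :
    ∃ (S : Type u) (M : Memory S C) (indices : S → C → Finset ι),
      ∀ c : ℕ → C, (⋃ n, A (c n) '' indices (M.after c n) (c n)) ∈ ℬ := by
  classical
  obtain ⟨σ, hσ, hwin⟩ := h
  let cover (c : C) : 𝒜 := ⟨range (A c), hA c⟩
  have hindices : ∀ (s : Σ n, Fin n → C) (c : C), ∃ I : Finset ι,
      A c '' I = σ s.1 (cover ∘ Fin.snoc s.2 c) := by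
    rintro ⟨n, s⟩ c
    have hsub : (σ n (cover ∘ Fin.snoc s c) : Set α) ⊆ A c '' univ := by
      simpa [cover] using hσ n (cover ∘ Fin.snoc s c)
    obtain ⟨I, -, hI⟩ := Finset.subset_set_image_iff.1 hsub
    exact ⟨I, by rw [← hI, Finset.coe_image]⟩
  choose indices hindices using hindices
  refine ⟨_, Memory.history C, indices, fun c => ?_⟩
  convert hwin (cover ∘ c) using 2
  funext n
  rw [hindices, Memory.after_history]
  exact congrArg (fun s => (σ n (cover ∘ s) : Set α))
    (Fin.snoc_init_self fun i : Fin (n + 1) => c i)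

theorem P2WinsSingle.exists_memory (h : P2WinsSingle 𝒜 ℬ) (A : C → ι → α)
    (hA : ∀ c, range (A c) ∈ 𝒜) :
    ∃ (S : Type u) (M : Memory S C) (index : S → C → ι),
      ∀ c : ℕ → C, range (fun n => A (c n) (index (M.after c n) (c n))) ∈ ℬ := by
  obtain ⟨σ, hσ, hwin⟩ := h
  let cover (c : C) : 𝒜 := ⟨range (A c), hA c⟩
  have hindex : ∀ (s : Σ n, Fin n → C) (c : C), ∃ i,
      A c i = σ s.1 (cover ∘ Fin.snoc s.2 c) := by
    rintro ⟨n, s⟩ c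
    simpa [cover] using hσ n (cover ∘ Fin.snoc s c)
  choose index hindex using hindex
  refine ⟨_, Memory.history C, index, fun c => ?_⟩
  convert hwin (cover ∘ c) using 2
  funext n
  rw [hindex, Memory.after_history]
  exact congrArg (fun s => σ n (cover ∘ s)) (Fin.snoc_init_self fun i : Fin (n + 1) => c i)

end Games

section Covers

variable {X : Type*} [TopologicalSpace X] {𝒰 : Set (Set X)}

theorem mem_openCovers_iff :
    𝒰 ∈ openCovers X ↔ (∀ U ∈ 𝒰, IsOpen U) ∧ ∀ x : X, ∃ U ∈ 𝒰, x ∈ U := by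
  simp only [openCovers, mem_ofPred_eq, eq_univ_iff_forall, mem_sUnion]

theorem mem_omegaCovers_iff :
    𝒰 ∈ omegaCovers X ↔ (∀ U ∈ 𝒰, IsOpen U) ∧ ∀ F : Finset X, ∃ U ∈ 𝒰, (F : Set X) ⊆ U := by
  constructor
  · rintro ⟨⟨hopen, -⟩, hF⟩
    exact ⟨hopen, fun F => hF F F.finite_toSet⟩
  · rintro ⟨hopen, hF⟩
    refine ⟨mem_openCovers_iff.2 ⟨hopen, fun x => ?_⟩, fun F hfin => ?_⟩
    · simpa using hF {x}
    · simpa using hF hfin.toFinset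

end Covers

section Menger

/-- An open neighbourhood assignment: each point is given one of its open neighbourhoods. In a
covering game such an assignment plays the role of the cover formed by its values, and Player 2
answers with points instead of members of the cover. -/
abbrev NbhdAssignment (X : Type*) [TopologicalSpace X] := ∀ x : X, OpenNhdsOf x

variable {X : Type u} [TopologicalSpace X] {Y : Type v} [TopologicalSpace Y]

theorem StrategicallyMenger.exists_memory (h : StrategicallyMenger X) :
    ∃ (S : Type u) (M : Memory S (NbhdAssignment X)) (points : S → NbhdAssignment X → Finset X),
      ∀ (O : ℕ → NbhdAssignment X) (y : X), ∃ n, ∃ x ∈ points (M.after O n) (O n), y ∈ O n x := by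
  obtain ⟨S, M, points, hwin⟩ := P2WinsFin.exists_memory h
    (fun (O : NbhdAssignment X) x => (O x : Set X)) fun O =>
      mem_openCovers_iff.2
        ⟨forall_mem_range.2 fun x => (O x).isOpen, fun x => ⟨_, ⟨x, rfl⟩, (O x).mem⟩⟩
  refine ⟨S, M, points, fun O y => ?_⟩
  simpa using (mem_openCovers_iff.1 (hwin O)).2 y

theorem StrategicallyMenger.of_memory {S : Type*} (M : Memory S (NbhdAssignment X))
    (points : S → NbhdAssignment X → Finset X)
    (hwin : ∀ (O : ℕ → NbhdAssignment X) (y : X),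
      ∃ n, ∃ x ∈ points (M.after O n) (O n), y ∈ O n x) : StrategicallyMenger X := by
  classical
  choose U hU hxU using fun 𝒰 : openCovers X => (mem_openCovers_iff.1 𝒰.2).2
  let assignment (𝒰 : openCovers X) : NbhdAssignment X :=
    fun x => ⟨⟨U 𝒰 x, 𝒰.2.1 _ (hU 𝒰 x)⟩, hxU 𝒰 x⟩
  have hanswer : ∀ s (𝒰 : openCovers X),
      (((points s (assignment 𝒰)).image (U 𝒰) : Finset (Set X)) : Set (Set X)) ⊆ 𝒰 := by
    intro s 𝒰
    rw [Finset.coe_image, image_subset_iff]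
    exact fun x _ => hU 𝒰 x
  refine P2WinsFin.of_memory (M.comap assignment) _ hanswer fun 𝒰 =>
    mem_openCovers_iff.2 ⟨fun V hV => ?_, fun y => ?_⟩
  · obtain ⟨n, hn⟩ := mem_iUnion.1 hV
    exact (𝒰 n).2.1 V (hanswer _ _ hn)
  · obtain ⟨n, x, hx, hy⟩ := hwin (assignment ∘ 𝒰) y
    rw [← Memory.after_comap] at hx
    exact ⟨U (𝒰 n) x, mem_iUnion.2 ⟨n, Finset.mem_image_of_mem _ hx⟩, hy⟩

theorem StrategicallyMenger.exists_memory_frequently (h : StrategicallyMenger X) :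
    ∃ (S : Type u) (M : Memory S (Finset (NbhdAssignment X)))
      (points : S → NbhdAssignment X → Finset X),
      ∀ (F : ℕ → Finset (NbhdAssignment X)) (O : ℕ → NbhdAssignment X) (P : ℕ → Prop),
        (∃ᶠ n in atTop, P n) → (∀ n, P n → O n ∈ F n) →
          ∀ y, ∃ n, P n ∧ ∃ x ∈ points (M.after F n) (O n), y ∈ O n x := by
  classical
  obtain ⟨S, M, points, hwin⟩ := h.exists_memory
  refine ⟨Finset S, M.branch, fun T O => T.biUnion (points · O), fun F O P hP hO y => ?_⟩
  obtain ⟨n, hn, t, ht, x, hx, hy⟩ := Memory.exists_mem_branch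
    (Q := fun s O => ∃ x ∈ points s O, y ∈ O x) (hwin · y) hP hO
  exact ⟨n, hn, x, Finset.mem_biUnion.2 ⟨t, ht, hx⟩, hy⟩

/-- If the point `y` were missed infinitely often, then the rounds in which it is missed would form
a lost play. -/
theorem StrategicallyMenger.exists_memory_eventually (h : StrategicallyMenger X) :
    ∃ (S : Type u) (M : Memory S (NbhdAssignment X)) (points : S → NbhdAssignment X → Finset X),
      ∀ (O : ℕ → NbhdAssignment X) (y : X),
        ∀ᶠ n in atTop, ∃ x ∈ points (M.after O n) (O n), y ∈ O n x := by
  obtain ⟨S, M, points, hwin⟩ := h.exists_memory_frequently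
  refine ⟨S, M.comap ({·}), points, fun O y => ?_⟩
  by_contra hmiss
  obtain ⟨n, hn, hy⟩ := hwin (fun n => {O n}) O _ (not_eventually.1 hmiss)
    (fun n _ => Finset.mem_singleton_self (O n)) y
  rw [Memory.after_comap] at hn
  exact hn hy

theorem StrategicallyMenger.of_compactSpace [CompactSpace X] : StrategicallyMenger X := by
  choose points hpoints using fun O : NbhdAssignment X =>
    CompactSpace.elim_nhds_subcover (fun x => (O x : Set X)) fun x =>
      (O x).isOpen.mem_nhds (O x).mem
  refine .of_memory (Memory.history _) (fun _ => points) fun O y => ⟨0, ?_⟩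
  simpa using (hpoints (O 0)).ge (mem_univ y)

theorem StrategicallyMenger.of_surjective (h : StrategicallyMenger X) {f : X → Y}
    (hf : Continuous f) (hsurj : Surjective f) : StrategicallyMenger Y := by
  classical
  obtain ⟨S, M, points, hwin⟩ := h.exists_memory
  let pullback (O : NbhdAssignment Y) : NbhdAssignment X := fun x =>
    OpenNhdsOf.comap ⟨f, hf⟩ x (O (f x))
  refine .of_memory (M.comap pullback) (fun s O => (points s (pullback O)).image f) fun O y => ?_
  obtain ⟨x', rfl⟩ := hsurj y
  obtain ⟨n, x, hx, hy⟩ := hwin (pullback ∘ O) x'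
  rw [← Memory.after_comap] at hx
  exact ⟨n, f x, Finset.mem_image_of_mem f hx, hy⟩

theorem exists_openNhdsOf_prod_subset {x : X} {y : Y} (W : OpenNhdsOf (x, y)) :
    ∃ (U : OpenNhdsOf x) (V : OpenNhdsOf y), (U : Set X) ×ˢ (V : Set Y) ⊆ W := by
  obtain ⟨U, V, hU, hV, hx, hy, hUV⟩ := isOpen_prod_iff.1 W.isOpen x y W.mem
  exact ⟨⟨⟨U, hU⟩, hx⟩, ⟨⟨V, hV⟩, hy⟩, hUV⟩

/-- Against the boxes `U O x y ×ˢ V O x y ⊆ O (x, y)`, Player 2 answers the assignment `V O x` on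
`Y` for each `x`, intersects the finitely many sets `U O x y` involved, and answers the resulting
assignment on `X` by a finite set of points `p`. The moves `V O p` then branch the game on `Y`. -/
theorem StrategicallyMenger.prod (hX : StrategicallyMenger X) (hY : StrategicallyMenger Y) :
    StrategicallyMenger (X × Y) := by
  classical
  obtain ⟨SX, MX, pointsX, hwinX⟩ := hX.exists_memory_eventually
  obtain ⟨SY, MY, pointsY, hwinY⟩ := hY.exists_memory_frequently
  choose U V hUV using fun (O : NbhdAssignment (X × Y)) (x : X) (y : Y) =>
    exists_openNhdsOf_prod_subset (O (x, y))
  let tube (t : SY) (O : NbhdAssignment (X × Y)) : NbhdAssignment X := fun x =>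
    (pointsY t (V O x)).inf (U O x)
  let xs (s : SX × SY) (O : NbhdAssignment (X × Y)) : Finset X := pointsX s.1 (tube s.2 O)
  let M : Memory (SX × SY) (NbhdAssignment (X × Y)) :=
    { start := (MX.start, MY.start)
      step := fun s O => (MX.step s.1 (tube s.2 O), MY.step s.2 ((xs s O).image (V O))) }
  refine .of_memory M
    (fun s O => (xs s O).biUnion fun x => (pointsY s.2 (V O x)).image (x, ·)) ?_
  rintro O ⟨x, y⟩
  have hMX : ∀ n, (M.after O n).1 = MX.after (fun k => tube (M.after O k).2 (O k)) n :=
    Memory.eq_after rfl fun _ => rfl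
  have hMY : ∀ n, (M.after O n).2 =
      MY.after (fun k => (xs (M.after O k) (O k)).image (V (O k))) n :=
    Memory.eq_after rfl fun _ => rfl
  let Covered (n : ℕ) : Prop :=
    ∃ p ∈ xs (M.after O n) (O n), x ∈ tube (M.after O n).2 (O n) p
  have hcovered : ∀ᶠ n in atTop, Covered n := by
    simpa only [Covered, xs, hMX] using hwinX (fun k => tube (M.after O k).2 (O k)) x
  have : Nonempty X := ⟨x⟩
  choose! p hp hxp using fun n (hn : Covered n) => hn
  obtain ⟨n, hn, q, hq, hyq⟩ := hwinY _ (fun n => V (O n) (p n)) _ hcovered.frequently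
    (fun n hn => Finset.mem_image_of_mem (V (O n)) (hp n hn)) y
  rw [← hMY] at hq
  have hxU : x ∈ U (O n) (p n) q := Finset.inf_le (f := U (O n) (p n)) hq (hxp n hn)
  exact ⟨n, (p n, q), Finset.mem_biUnion.2 ⟨p n, hp n hn, Finset.mem_image_of_mem _ hq⟩,
    hUV (O n) (p n) q ⟨hxU, hyq⟩⟩

theorem StrategicallyMenger.pi_fin {m : ℕ} {X : Fin m → Type u} [∀ i, TopologicalSpace (X i)]
    (h : ∀ i, StrategicallyMenger (X i)) : StrategicallyMenger (∀ i, X i) := by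
  induction m with
  | zero => exact .of_compactSpace
  | succ m ih =>
    refine ((h 0).prod (ih fun i => h i.succ)).of_surjective
      (f := fun z : X 0 × ∀ i : Fin m, X i.succ => Fin.cons z.1 z.2) (by fun_prop) fun z => ?_
    exact ⟨(z 0, Fin.tail z), Fin.cons_self_tail z⟩

/-- A set of `m` points is the range of a point of `X ^ m`, and an `ω`-cover `𝒰` gives the cover of
`X ^ m` by the sets `U ^ m` with `U ∈ 𝒰`. -/
theorem StrategicallyMenger.exists_memory_omegaCovers (h : StrategicallyMenger X) (m : ℕ) :
    ∃ (S : Type u) (M : Memory S (omegaCovers X)) (answer : S → omegaCovers X → Finset (Set X)),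
      (∀ s 𝒰, ∀ V ∈ answer s 𝒰, V ∈ (𝒰 : Set (Set X))) ∧
      ∀ (𝒰 : ℕ → omegaCovers X) (F : Finset X), F.card = m →
        ∀ᶠ n in atTop, ∃ V ∈ answer (M.after 𝒰 n) (𝒰 n), (F : Set X) ⊆ V := by
  classical
  obtain ⟨S, M, points, hwin⟩ :=
    (StrategicallyMenger.pi_fin fun _ : Fin m => h).exists_memory_eventually
  choose U hU hsub using fun 𝒰 : omegaCovers X => (mem_omegaCovers_iff.1 𝒰.2).2
  let selected (𝒰 : omegaCovers X) (z : Fin m → X) : Set X := U 𝒰 (Finset.univ.image z)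
  let assignment (𝒰 : omegaCovers X) : NbhdAssignment (Fin m → X) := fun z =>
    ⟨⟨univ.pi fun _ => selected 𝒰 z,
      isOpen_set_pi finite_univ fun _ _ => 𝒰.2.1.1 _ (hU _ _)⟩, fun i _ => hsub _ _ (by simp)⟩
  refine ⟨S, M.comap assignment, fun s 𝒰 => (points s (assignment 𝒰)).image (selected 𝒰),
    fun s 𝒰 => Finset.forall_mem_image.2 fun z _ => hU _ _, fun 𝒰 F hF => ?_⟩
  let e := F.equivFinOfCardEq hF
  filter_upwards [hwin (assignment ∘ 𝒰) fun i => e.symm i] with n ⟨z, hz, hFz⟩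
  rw [← Memory.after_comap] at hz
  refine ⟨selected (𝒰 n) z, Finset.mem_image_of_mem _ hz, fun x hx => ?_⟩
  simpa only [Equiv.symm_apply_apply] using hFz (e ⟨x, hx⟩) (mem_univ _)

theorem StrategicallyMenger.strategicallyOmegaMenger (h : StrategicallyMenger X) :
    StrategicallyOmegaMenger X := by
  choose S M answer hanswer hwin using h.exists_memory_omegaCovers
  obtain ⟨N, joint, hjoint, hsub⟩ := Memory.exists_answer_superset M answer
  have hmem : ∀ s (𝒰 : omegaCovers X), (joint s 𝒰 : Set (Set X)) ⊆ 𝒰 := by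
    intro s 𝒰 V hV
    obtain ⟨m, t, ht⟩ := hjoint s 𝒰 V hV
    exact hanswer m t 𝒰 V ht
  refine P2WinsFin.of_memory N joint hmem fun 𝒰 =>
    mem_omegaCovers_iff.2 ⟨fun V hV => ?_, fun F => ?_⟩
  · obtain ⟨n, hn⟩ := mem_iUnion.1 hV
    exact (𝒰 n).2.1.1 V (hmem _ _ hn)
  · obtain ⟨n, ⟨V, hV, hFV⟩, hn⟩ :=
      ((hwin F.card 𝒰 F rfl).and (eventually_ge_atTop F.card)).exists
    exact ⟨V, mem_iUnion.2 ⟨n, hsub 𝒰 F.card n hn hV⟩, hFV⟩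

theorem StrategicallyOmegaMenger.strategicallyMenger (h : StrategicallyOmegaMenger X) :
    StrategicallyMenger X := by
  classical
  let finiteUnion (O : NbhdAssignment X) (F : Finset X) : Set X := ⋃ x ∈ F, (O x : Set X)
  obtain ⟨S, M, sets, hwin⟩ := P2WinsFin.exists_memory h finiteUnion fun O =>
    mem_omegaCovers_iff.2 ⟨forall_mem_range.2 fun F => isOpen_biUnion fun x _ => (O x).isOpen,
      fun F => ⟨_, ⟨F, rfl⟩, fun x hx => mem_biUnion hx (O x).mem⟩⟩
  refine .of_memory M (fun s O => (sets s O).biUnion id) fun O y => ?_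
  obtain ⟨V, hV, hy⟩ := (mem_openCovers_iff.1 (hwin O).1).2 y
  obtain ⟨n, F, hF, rfl⟩ := mem_iUnion.1 hV
  obtain ⟨x, hx, hy⟩ := mem_iUnion₂.1 hy
  exact ⟨n, x, Finset.mem_biUnion.2 ⟨F, hF, hx⟩, hy⟩

end Menger

section Duality

variable {α : Type u} {ι : Type v} {ℬ : Set (Set α)}

/-- Player 1 has a winning strategy in the game in which, in each round, Player 1 names a target
`i : ι`, Player 2 answers with a member of `N i`, and Player 1 wins when the set of all answers
belongs to `ℬ`. The point-open game is the case where `N x` consists of the open neighbourhoods of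
the point `x`, the finite-open game the analogous one for finite sets. -/
def P1WinsTargets (N : ι → Set α) (ℬ : Set (Set α)) : Prop :=
  ∃ (S : Type (max u v)) (M : Memory S α) (target : S → ι),
    ∀ U : ℕ → α, (∀ n, U n ∈ N (target (M.after U n))) → range U ∈ ℬ

/-- Galvin's argument: in every state there is a target `i` such that each member of `N i` is
Player 2's answer to some move of Player 1, for otherwise a bad choice of one member from each
`N i` would make up a move that Player 2 cannot answer. -/
theorem P2WinsSingle.p1WinsTargets {𝒜 : Set (Set α)} {N : ι → Set α}
    (hN : ∀ f : ι → α, (∀ i, f i ∈ N i) → range f ∈ 𝒜) (h : P2WinsSingle 𝒜 ℬ) :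
    P1WinsTargets N ℬ := by
  classical
  obtain ⟨S, M, index, hwin⟩ := h.exists_memory (fun (f : ∀ i, N i) i => (f i : α)) fun f =>
    hN _ fun i => (f i).2
  have hforce : ∀ s, ∃ i, ∀ U : N i, ∃ f : ∀ i, N i, (f (index s f) : α) = U := by
    intro s
    by_contra! hbad
    choose f hf using hbad
    exact hf (index s f) f rfl
  choose target move hmove using hforce
  let reader : Memory S α :=
    { start := M.start
      step := fun s U => if hU : U ∈ N (target s) then M.step s (move s ⟨U, hU⟩) else s }
  refine ⟨S, reader, target, fun U hU => ?_⟩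
  let f (n : ℕ) : ∀ i, N i := move (reader.after U n) ⟨U n, hU n⟩
  have hreader : ∀ n, reader.after U n = M.after f n :=
    Memory.eq_after rfl fun n => dif_pos (hU n)
  convert hwin f using 2
  funext n
  rw [← hreader]
  exact (hmove _ ⟨U n, hU n⟩).symm

theorem P1WinsTargets.p2WinsSingle {𝒜 : Set (Set α)} {N : ι → Set α}
    (hN : ∀ A ∈ 𝒜, ∀ i, ∃ U ∈ A, U ∈ N i) (h : P1WinsTargets N ℬ) : P2WinsSingle 𝒜 ℬ := by
  obtain ⟨S, M, target, hwin⟩ := h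
  choose answer hanswer hmem using fun A : 𝒜 => hN A A.2
  let reader : Memory S 𝒜 :=
    { start := M.start
      step := fun s A => M.step s (answer A (target s)) }
  refine P2WinsSingle.of_memory reader (fun s A => answer A (target s)) (fun _ A => hanswer A _)
    fun A => hwin _ fun n => ?_
  have hreader : ∀ n, reader.after A n =
      M.after (fun k => answer (A k) (target (reader.after A k))) n :=
    Memory.eq_after rfl fun _ => rfl
  rw [← hreader]
  exact hmem _ _

end Duality

section Pointwise

variable {X : Type*}

theorem exists_subset_of_forall_not_subset {F : Finset X} {a : ℕ → Set X} (hmono : Monotone a)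
    (ha : ∀ n, ¬ (F : Set X) ⊆ a n → ∃ x ∈ F, x ∉ a n ∧ x ∈ a (n + 1)) :
    ∃ n, (F : Set X) ⊆ a n := by
  classical
  by_contra! hF
  refine not_strictAnti_of_wellFoundedLT (fun n => F.filter (· ∉ a n))
    (strictAnti_nat_of_succ_lt fun n => ?_)
  obtain ⟨x, hx, hxn, hxs⟩ := ha n (hF n)
  refine (Finset.ssubset_iff_of_subset ?_).2 ⟨x, by simp [hx, hxn], by simp [hxs]⟩
  exact Finset.monotone_filter_right F fun y _ h hy => h (hmono n.le_succ hy)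

open Classical in
/-- The machine with which Player 1 plays the point-open game, given a machine `M` and a choice
`target` of finite sets for the finite-open game: besides a state of `M` it stores the union of the
sets played so far, and `M` reads that union as soon as it contains the current target. -/
noncomputable def pointwise {S : Type*} (M : Memory S (Set X)) (target : S → Finset X) :
    Memory (S × Set X) (Set X) where
  start := (M.start, ∅)
  step s U :=
    (if (target s.1 : Set X) ⊆ s.2 ∪ U then M.step s.1 (s.2 ∪ U) else s.1, s.2 ∪ U)

variable {S : Type*} {M : Memory S (Set X)} {target : S → Finset X} {U : ℕ → Set X}

theorem pointwise_after_succ_snd (n : ℕ) :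
    ((pointwise M target).after U (n + 1)).2 = accumulate U n := by
  induction n with
  | zero => simp [Memory.after, pointwise]
  | succ n ih => rw [accumulate_succ, ← ih]; rfl

open Classical in
theorem pointwise_after_succ_fst (n : ℕ) :
    ((pointwise M target).after U (n + 1)).1 =
      if (target ((pointwise M target).after U n).1 : Set X) ⊆ accumulate U n
      then M.step ((pointwise M target).after U n).1 (accumulate U n)
      else ((pointwise M target).after U n).1 := by
  rw [← pointwise_after_succ_snd (M := M) (target := target)]
  rfl

theorem frequently_target_subset_accumulate
    (hU : ∀ n, ¬ (target ((pointwise M target).after U n).1 : Set X) ⊆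
        ((pointwise M target).after U n).2 →
      ∃ x ∈ target ((pointwise M target).after U n).1,
        x ∉ ((pointwise M target).after U n).2 ∧ x ∈ U n) :
    ∃ᶠ n in atTop, (target ((pointwise M target).after U n).1 : Set X) ⊆ accumulate U n := by
  by_contra hnot
  obtain ⟨N, hN⟩ := eventually_atTop.1 (not_frequently.1 hnot)
  have hconst : ∀ k, ((pointwise M target).after U (N + k)).1 =
      ((pointwise M target).after U N).1 := by
    intro k
    induction k with
    | zero => rfl
    | succ k ih => rw [← add_assoc, pointwise_after_succ_fst, if_neg (hN _ (by lia)), ih]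
  obtain ⟨k, hk⟩ := exists_subset_of_forall_not_subset (a := fun k => accumulate U (N + k))
    (F := target ((pointwise M target).after U N).1)
    (fun i j hij => monotone_accumulate (by lia)) fun k hk => by
      have hround := hU (N + (k + 1))
      rw [hconst, ← add_assoc, pointwise_after_succ_snd] at hround
      obtain ⟨x, hx, hxk, hxU⟩ := hround hk
      exact ⟨x, hx, hxk, subset_accumulate hxU⟩
  exact hN (N + k) (by lia) (by rwa [hconst])

end Pointwise

section Rothberger

variable {X : Type u} [TopologicalSpace X]

theorem strategicallyRothberger_iff_p1WinsTargets :
    StrategicallyRothberger X ↔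
      P1WinsTargets (fun x : X => {U | IsOpen U ∧ x ∈ U}) (openCovers X) := by
  constructor
  · exact P2WinsSingle.p1WinsTargets fun f hf => mem_openCovers_iff.2
      ⟨forall_mem_range.2 fun x => (hf x).1, fun x => ⟨_, ⟨x, rfl⟩, (hf x).2⟩⟩
  · refine P1WinsTargets.p2WinsSingle fun 𝒰 h𝒰 x => ?_
    obtain ⟨U, hU, hx⟩ := (mem_openCovers_iff.1 h𝒰).2 x
    exact ⟨U, hU, h𝒰.1 U hU, hx⟩

theorem strategicallyOmegaRothberger_iff_p1WinsTargets :
    StrategicallyOmegaRothberger X ↔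
      P1WinsTargets (fun F : Finset X => {U | IsOpen U ∧ (F : Set X) ⊆ U}) (omegaCovers X) := by
  constructor
  · exact P2WinsSingle.p1WinsTargets fun f hf => mem_omegaCovers_iff.2
      ⟨forall_mem_range.2 fun F => (hf F).1, fun F => ⟨_, ⟨F, rfl⟩, (hf F).2⟩⟩
  · refine P1WinsTargets.p2WinsSingle fun 𝒰 h𝒰 F => ?_
    obtain ⟨U, hU, hF⟩ := (mem_omegaCovers_iff.1 h𝒰).2 F
    exact ⟨U, hU, h𝒰.1.1 U hU, hF⟩

/-- In the finite-open game Player 1 names all points that the strategy for the point-open game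
would name after some subsequence of the play, so that every point is missed finitely often. -/
theorem StrategicallyRothberger.strategicallyOmegaRothberger (h : StrategicallyRothberger X) :
    StrategicallyOmegaRothberger X := by
  classical
  obtain ⟨S, M, target, hwin⟩ := strategicallyRothberger_iff_p1WinsTargets.1 h
  refine strategicallyOmegaRothberger_iff_p1WinsTargets.2
    ⟨Finset S, M.branch.comap ({·}), fun T => T.image target, fun U hU => ?_⟩
  have hcover : ∀ x (V : ℕ → Set X), ∃ n,
      (IsOpen (V n) ∧ target (M.after V n) ∈ V n → x ∈ V n) := by
    intro x V
    by_contra! hmiss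
    obtain ⟨_, ⟨n, rfl⟩, hx⟩ := (mem_openCovers_iff.1 (hwin V fun n => (hmiss n).1)).2 x
    exact (hmiss n).2 hx
  have hev : ∀ x, ∀ᶠ n in atTop, x ∈ U n := by
    intro x
    by_contra hmiss
    obtain ⟨n, hn, t, ht, hx⟩ := Memory.exists_mem_branch
      (Q := fun s V => IsOpen V ∧ target s ∈ V → x ∈ V) (hcover x)
      (not_eventually.1 hmiss) fun n _ => Finset.mem_singleton_self (U n)
    have hreach : t ∈ (M.branch.comap ({·})).after U n := by rwa [Memory.after_comap]
    exact hn (hx ⟨(hU n).1, (hU n).2 (Finset.mem_image_of_mem target hreach)⟩)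
  refine mem_omegaCovers_iff.2 ⟨forall_mem_range.2 fun n => (hU n).1, fun F => ?_⟩
  obtain ⟨n, hn⟩ := ((eventually_all_finset F).2 fun x _ => hev x).exists
  exact ⟨U n, ⟨n, rfl⟩, hn⟩

theorem StrategicallyOmegaRothberger.strategicallyRothberger [Nonempty X]
    (h : StrategicallyOmegaRothberger X) : StrategicallyRothberger X := by
  classical
  obtain ⟨S, M, target, hwin⟩ := strategicallyOmegaRothberger_iff_p1WinsTargets.1 h
  have hpoint : ∀ (F : Finset X) (a : Set X), ∃ x, ¬ (F : Set X) ⊆ a → x ∈ F ∧ x ∉ a := by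
    intro F a
    by_cases hF : (F : Set X) ⊆ a
    · exact ⟨Classical.arbitrary X, fun h => absurd hF h⟩
    · obtain ⟨x, hx⟩ := not_subset.1 hF
      exact ⟨x, fun _ => hx⟩
  choose point hpoint using hpoint
  refine strategicallyRothberger_iff_p1WinsTargets.2
    ⟨S × Set X, pointwise M target, fun s => point (target s.1) s.2, fun U hU => ?_⟩
  have hopen : ∀ n, IsOpen (accumulate U n) := fun n => isOpen_biUnion fun k _ => (hU k).1
  let P (n : ℕ) : Prop :=
    (target ((pointwise M target).after U n).1 : Set X) ⊆ accumulate U n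
  have hP : {n | P n}.Infinite := by
    refine Nat.frequently_atTop_iff_infinite.1 (frequently_target_subset_accumulate fun n hn => ?_)
    obtain ⟨hF, ha⟩ := hpoint _ _ hn
    exact ⟨_, hF, ha, (hU n).2⟩
  have hafter := Memory.eq_after_nth_count (P := P) (A := accumulate U) (M := M)
    (s := fun n => ((pointwise M target).after U n).1) rfl pointwise_after_succ_fst
  have hω := hwin (accumulate U ∘ Nat.nth P) fun k => ⟨hopen _, by
    have hstate := hafter (Nat.nth P k)
    rw [Nat.count_nth_of_infinite hP] at hstate
    exact hstate ▸ Nat.nth_mem_of_infinite hP k⟩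
  refine mem_openCovers_iff.2 ⟨forall_mem_range.2 fun n => (hU n).1, fun x => ?_⟩
  obtain ⟨_, ⟨k, rfl⟩, hx⟩ := (mem_openCovers_iff.1 hω.1).2 x
  obtain ⟨n, -, hn⟩ := mem_accumulate.1 hx
  exact ⟨U n, ⟨n, rfl⟩, hn⟩

end Rothberger

theorem mainTheorem5 (X : Type*) [TopologicalSpace X] :
    (StrategicallyOmegaMenger X ↔ StrategicallyMenger X) ∧
    (Nonempty X → (StrategicallyOmegaRothberger X ↔ StrategicallyRothberger X)) :=
  ⟨⟨fun h => h.strategicallyMenger, fun h => h.strategicallyOmegaMenger⟩,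
    fun _ => ⟨fun h => h.strategicallyRothberger, fun h => h.strategicallyOmegaRothberger⟩⟩
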